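/- Let $E \subseteq \mathbf{R}^n$ be a closed set that is a $d$-dimensional Lipschitz submanifold (every point of $E$ has a relatively open neighbourhood in $E$ that is the bi-Lipschitz image of an open subset of $\mathbf{R}^d$), and suppose that there is a $k \ge 1$ such that any two points $x, y \in E$ can be joined by a path in $E$ of length at most $k\,|x-y|$. Let $f : E \to \mathbf{R}$ be locally Lipschitz. Then, at $\mathcal{H}^d$-almost every $x \in E$, $E$ has a tangent plane, i.e. there is a $d$-dimensional linear subspace $T_x$ of $\mathbf{R}^n$ with $\operatorname{dist}(y-x, T_x) = o(|y-x|)$ as $y \to x$ in $E$ and $\operatorname{dist}(x+v, E) = o(|v|)$ as $v \to 0$ in $T_x$, and $f$ has a differential on it, i.e. a linear functional $L_x$ on $T_x$ with $f(y) = f(x) + L_x(P_{T_x}(y-x)) + o(|y-x|)$ as $y \to x$ in $E$, where $P_{T_x}$ is the orthogonal projection of $\mathbf{R}^n$ onto $T_x$. Moreover, if $A$ is a continuous function on $E$ with values in the linear functionals on $\mathbf{R}^n$ such that $L_x$ is the restriction of $A(x)$ to $T_x$ for $\mathcal{H}^d$-almost every $x \in E$, then $f$ is continuously differentiable on $E$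 in Whitney's sense, with differential $A(x)$ at $x \in E$: for every $a \in E$, $f(y) - f(x) - A(x)(y-x) = o(|y-x|)$ as $x, y \to a$ in $E$. -/

import Mathlib

open Set Filter Topology MeasureTheory Asymptotics
open scoped NNReal ENNReal

/-- `E ⊆ ℝⁿ` is a `d`-dimensional Lipschitz submanifold (without boundary): every point of `E` has
a relatively open neighbourhood in `E` that is the image of an open subset of `ℝᵈ` under a
bi-Lipschitz map. -/
def IsLipschitzSubmanifold {n : ℕ} (d : ℕ) (E : Set (EuclideanSpace ℝ (Fin n))) : Prop :=
  ∀ x ∈ E, ∃ (U : Set (EuclideanSpace ℝ (Fin d)))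
    (φ : EuclideanSpace ℝ (Fin d) → EuclideanSpace ℝ (Fin n))
    (V : Set (EuclideanSpace ℝ (Fin n))) (K : ℝ≥0),
    IsOpen U ∧ IsOpen V ∧ x ∈ V ∧ φ '' U = E ∩ V ∧
      LipschitzOnWith K φ U ∧ AntilipschitzWith K (U.domRestrict φ)

/-- Any two points `x, y ∈ E` can be joined by a path in `E` of length at most `k * |x - y|`. -/
def PathCondition {n : ℕ} (k : ℝ) (E : Set (EuclideanSpace ℝ (Fin n))) : Prop :=
  ∀ x ∈ E, ∀ y ∈ E, ∃ p : ℝ → EuclideanSpace ℝ (Fin n),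
    ContinuousOn p (Icc 0 1) ∧ MapsTo p (Icc 0 1) E ∧ p 0 = x ∧ p 1 = y ∧
      eVariationOn p (Icc 0 1) ≤ ENNReal.ofReal (k * dist x y)

/-- The `d`-dimensional linear subspace `T` is the (direction of the) tangent plane to `E` at `x`:
near `x`, the sets `E` and `x + T` approximate each other to first order. -/
def IsTangentPlane {n : ℕ} (d : ℕ) (E : Set (EuclideanSpace ℝ (Fin n)))
    (x : EuclideanSpace ℝ (Fin n)) (T : Submodule ℝ (EuclideanSpace ℝ (Fin n))) : Prop :=
  Module.finrank ℝ T = d ∧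
  (fun y => Metric.infDist (y - x) (T : Set (EuclideanSpace ℝ (Fin n))))
    =o[𝓝[E] x] (fun y => y - x) ∧
  (fun v => Metric.infDist (x + v) E)
    =o[𝓝[(T : Set (EuclideanSpace ℝ (Fin n)))] 0] (fun v => v)

/-- The linear functional `L` on `T` is the differential at `x` of the function `f` on `E`:
`f y = f x + L (P_T (y - x)) + o(|y - x|)` as `y → x` in `E`, where `P_T` is the orthogonal
projection onto `T`. Only values of `f` on `E` matter when `x ∈ E`. -/
def HasTangentDifferential {n : ℕ} (E : Set (EuclideanSpace ℝ (Fin n)))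
    (f : EuclideanSpace ℝ (Fin n) → ℝ) (x : EuclideanSpace ℝ (Fin n))
    (T : Submodule ℝ (EuclideanSpace ℝ (Fin n))) (L : T →L[ℝ] ℝ) : Prop :=
  (fun y => f y - f x - L (T.orthogonalProjectionOnto (y - x))) =o[𝓝[E] x] (fun y => y - x)

/-- `f` is continuously differentiable on `E` in the sense of Whitney, with differential `A x` at
`x ∈ E`: `A` is continuous on `E`, and for every `a ∈ E`,
`f y - f x - A x (y - x) = o(|y - x|)` as `x, y → a` in `E`. -/
def IsWhitneyC1With {n : ℕ} (E : Set (EuclideanSpace ℝ (Fin n)))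
    (f : EuclideanSpace ℝ (Fin n) → ℝ)
    (A : EuclideanSpace ℝ (Fin n) → (EuclideanSpace ℝ (Fin n) →L[ℝ] ℝ)) : Prop :=
  ContinuousOn A E ∧
  ∀ a ∈ E, (fun p : EuclideanSpace ℝ (Fin n) × EuclideanSpace ℝ (Fin n) =>
      f p.2 - f p.1 - A p.1 (p.2 - p.1)) =o[𝓝[E ×ˢ E] (a, a)] (fun p => p.2 - p.1)

/-!
A Lipschitz submanifold is locally the image of a bi-Lipschitz chart `φ` defined on an open subset
of `ℝᵈ`, and `φ` and its inverse carry `μH[d]`-null sets to `μH[d]`-null sets. By Rademacher's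
theorem, `φ` and `f ∘ φ` are differentiable almost everywhere. At a point `u` where both are, the
differential `D` of `φ` is injective with inverse bounded by the Lipschitz constant of `φ⁻¹`, its
range is the tangent plane at `φ u`, and the differential of `f` on it is the differential of
`f ∘ φ` composed with `D⁻¹` (`IsBilipschitzChart.isTangentPlane`,
`IsBilipschitzChart.exists_hasTangentDifferential`). All the first-order estimates are transported
from the chart to `E` by `IsBilipschitzChart.isLittleO_nhdsWithin`.

For the second part, let `a = φ u` be a point of `E` and consider `h = f - A a`. Almost everywhere
near `u`, the gradient of `h ∘ φ` at `w` is `(A (φ w) - A a) ∘ D`, which is at most `ε K` on a small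
ball. A Lipschitz function on a convex open set whose gradient is bounded almost everywhere is
Lipschitz with that bound as a constant (`lipschitzOnWith_of_ae_norm_fderiv_le`, by Fubini and the
fundamental theorem of calculus on lines). Hence `h` is `ε K²`-Lipschitz on `E` near `a`
(`IsBilipschitzChart.exists_nhds_lipschitzOnWith_sub`), and replacing `A a` by `A x` costs another
`ε |y - x|`. A small ball of the chart joins nearby points of `E` by curves of comparable length, so
this local argument suffices.
-/

/-! ### Lipschitz functions with a small gradient almost everywhere -/

/-- Along a segment in `s`, a Lipschitz function is the integral of its derivative, so it suffices
to bound the gradient at almost every point of this one segment. -/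
theorem abs_sub_le_of_ae_segment {F : Type*} [NormedAddCommGroup F] [NormedSpace ℝ F]
    {s : Set F} (hs : Convex ℝ s) {g : F → ℝ} {K C : ℝ≥0} (hg : LipschitzOnWith K g s)
    {p w : F} (hp : p ∈ s) (hpw : p + w ∈ s)
    (h : ∀ᵐ t : ℝ, p + t • w ∈ s →
      DifferentiableAt ℝ g (p + t • w) ∧ ‖fderiv ℝ g (p + t • w)‖ ≤ C) :
    |g (p + w) - g p| ≤ C * ‖w‖ := by
  set c : ℝ → F := fun t => p + t • w with hc
  have hcs : MapsTo c (uIcc 0 1) s := by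
    intro t ht
    rw [uIcc_of_le zero_le_one] at ht
    exact hs.add_smul_mem hp hpw ht
  have hclip : LipschitzWith ‖w‖₊ c := by
    refine LipschitzWith.of_dist_le_mul fun t t' => ?_
    rw [dist_eq_norm, hc]
    simp only [add_sub_add_left_eq_sub, ← sub_smul, norm_smul, coe_nnnorm, Real.dist_eq,
      Real.norm_eq_abs]
    exact (mul_comm _ _).le
  have hac : AbsolutelyContinuousOnInterval (g ∘ c) 0 1 :=
    (hg.comp hclip.lipschitzOnWith hcs).absolutelyContinuousOnInterval
  have hFTC := hac.integral_deriv_eq_sub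
  have hbound : ∀ᵐ t : ℝ, t ∈ uIoc (0 : ℝ) 1 → ‖deriv (g ∘ c) t‖ ≤ C * ‖w‖ := by
    filter_upwards [h] with t ht htI
    obtain ⟨hd, hn⟩ := ht (hcs (uIoc_subset_uIcc htI))
    have hcd : HasDerivAt c w t := by
      simpa [hc] using ((hasDerivAt_id t).smul_const w).const_add p
    rw [(hd.hasFDerivAt.comp_hasDerivAt t hcd).deriv]
    exact (ContinuousLinearMap.le_opNorm _ _).trans (by gcongr)
  have := intervalIntegral.norm_integral_le_of_norm_le_const_ae hbound
  rw [hFTC] at this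
  simpa [hc] using this

/-- A Lipschitz function on an open convex set whose gradient is bounded by `C` almost everywhere is
`C`-Lipschitz. By Fubini, almost every translate of a given segment meets the exceptional null set in
a null set, and the estimate passes to the remaining translates by continuity. -/
theorem lipschitzOnWith_of_ae_norm_fderiv_le {F : Type*} [NormedAddCommGroup F] [NormedSpace ℝ F]
    [FiniteDimensional ℝ F] [MeasurableSpace F] [BorelSpace F] (μ : Measure F) [μ.IsAddHaarMeasure]
    {s : Set F} (hs : Convex ℝ s) (hso : IsOpen s) {g : F → ℝ} {K C : ℝ≥0}
    (hg : LipschitzOnWith K g s)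
    (h : ∀ᵐ x ∂μ, x ∈ s → DifferentiableAt ℝ g x ∧ ‖fderiv ℝ g x‖ ≤ C) :
    LipschitzOnWith C g s := by
  refine LipschitzOnWith.of_dist_le_mul fun v hv u hu => ?_
  set w := v - u with hw
  have hvw : u + w = v := by simp [hw]
  set N := toMeasurable μ {x | ¬ (x ∈ s → DifferentiableAt ℝ g x ∧ ‖fderiv ℝ g x‖ ≤ C)}
  have hN : μ N = 0 := by rw [measure_toMeasurable]; exact h
  have hNm : MeasurableSet N := measurableSet_toMeasurable _ _
  have hfub : ∀ᵐ p ∂μ, ∀ᵐ t : ℝ, p + t • w ∉ N := by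
    have hmeas : MeasurableSet {x : F × ℝ | x.1 + x.2 • w ∉ N} :=
      (show Measurable fun x : F × ℝ => x.1 + x.2 • w from
        (by fun_prop : Continuous fun x : F × ℝ => x.1 + x.2 • w).measurable) hNm.compl
    rw [Measure.ae_ae_comm (p := fun (p : F) (t : ℝ) => p + t • w ∉ N) hmeas]
    refine Eventually.of_forall fun t => ?_
    have : μ ((fun p => p + t • w) ⁻¹' N) = 0 := by rwa [measure_preimage_add_right]
    exact measure_eq_zero_iff_ae_notMem.1 this
  have hdense := (Measure.dense_of_ae hfub) u
  rw [mem_closure_iff_nhdsWithin_neBot] at hdense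
  have hgc : ContinuousOn g s := hg.continuousOn
  have hmap : Tendsto (fun p => p + w) (𝓝 u) (𝓝 v) := by
    rw [← hvw]; exact (continuous_id.add continuous_const).tendsto u
  have hlim : Tendsto (fun p => |g (p + w) - g p|) (𝓝 u) (𝓝 |g v - g u|) :=
    ((((hgc.continuousAt (hso.mem_nhds hv)).tendsto.comp hmap)).sub
      (hgc.continuousAt (hso.mem_nhds hu)).tendsto).abs
  rw [Real.dist_eq, dist_eq_norm]
  refine le_of_tendsto
    (hlim.mono_left (nhdsWithin_le_nhds (s := {p | ∀ᵐ t : ℝ, p + t • w ∉ N}))) ?_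
  filter_upwards [self_mem_nhdsWithin, nhdsWithin_le_nhds (hso.mem_nhds hu),
    nhdsWithin_le_nhds (hmap (hso.mem_nhds hv))] with p hpN hps hpws
  refine abs_sub_le_of_ae_segment hs hg hps hpws ?_
  filter_upwards [hpN] with t ht
  by_contra hcon
  exact ht (subset_toMeasurable _ _ hcon)

/-! ### Bi-Lipschitz charts and their differentials -/

/-- `φ` maps the open set `U` onto the relatively open subset `E ∩ V` of `E`, and it is bi-Lipschitz
on `U`: both `φ` and its inverse are `K`-Lipschitz. -/
structure IsBilipschitzChart {F G : Type*} [NormedAddCommGroup F] [NormedAddCommGroup G]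
    (K : ℝ≥0) (φ : F → G) (U : Set F) (E V : Set G) : Prop where
  isOpen_source : IsOpen U
  isOpen_target : IsOpen V
  image_eq : φ '' U = E ∩ V
  lipschitz : LipschitzOnWith K φ U
  dist_le : ∀ u ∈ U, ∀ w ∈ U, dist u w ≤ K * dist (φ u) (φ w)

namespace IsBilipschitzChart

variable {F G : Type*} [NormedAddCommGroup F] [NormedAddCommGroup G]
  {K : ℝ≥0} {φ : F → G} {U : Set F} {E V : Set G} {u : F}

theorem mem_image (h : IsBilipschitzChart K φ U E V) (hu : u ∈ U) : φ u ∈ E ∩ V :=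
  h.image_eq ▸ mem_image_of_mem φ hu

/-- Points of `E` near `φ u` are images of points near `u`. -/
theorem nhdsWithin_le_map (h : IsBilipschitzChart K φ U E V) (hu : u ∈ U) :
    𝓝[E] (φ u) ≤ map φ (𝓝 u) := by
  intro s hs
  obtain ⟨r, hr, hrs⟩ := Metric.mem_nhds_iff.1 (mem_map.1 hs)
  have hK : (0 : ℝ) < K + 1 := by positivity
  filter_upwards [self_mem_nhdsWithin,
    nhdsWithin_le_nhds (h.isOpen_target.mem_nhds (h.mem_image hu).2),
    nhdsWithin_le_nhds (Metric.ball_mem_nhds (φ u) (div_pos hr hK))] with y hyE hyV hy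
  obtain ⟨w, hw, rfl⟩ : y ∈ φ '' U := h.image_eq ▸ ⟨hyE, hyV⟩
  refine hrs ?_
  rw [Metric.mem_ball, lt_div_iff₀ hK] at hy
  rw [Metric.mem_ball]
  nlinarith [h.dist_le w hw u hu, dist_nonneg (x := φ w) (y := φ u)]

/-- A first-order estimate in the chart is a first-order estimate on `E`. -/
theorem isLittleO_nhdsWithin (h : IsBilipschitzChart K φ U E V) (hu : u ∈ U)
    {H : Type*} [NormedAddCommGroup H] {g : G → H}
    (hg : (fun w => g (φ w)) =o[𝓝 u] fun w => w - u) :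
    g =o[𝓝[E] (φ u)] fun y => y - φ u := by
  refine IsLittleO.mono ?_ (h.nhdsWithin_le_map hu)
  rw [isLittleO_map]
  refine hg.trans_isBigO (IsBigO.of_bound K ?_)
  filter_upwards [h.isOpen_source.mem_nhds hu] with w hw
  simpa [dist_eq_norm] using h.dist_le w hw u hu

variable [NormedSpace ℝ F] [NormedSpace ℝ G] {D : F →L[ℝ] G}

theorem norm_le_mul_norm_fderiv (h : IsBilipschitzChart K φ U E V) (hu : u ∈ U)
    (hD : HasFDerivAt φ D u) (w : F) : ‖w‖ ≤ K * ‖D w‖ := by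
  have hlim := (hD.hasLineDerivAt w).tendsto_slope_zero
  have hmem : ∀ᶠ t : ℝ in 𝓝[≠] 0, u + t • w ∈ U := by
    have : Tendsto (fun t : ℝ => u + t • w) (𝓝 0) (𝓝 u) := by
      have := (by fun_prop : Continuous fun t : ℝ => u + t • w).tendsto 0
      simpa using this
    exact nhdsWithin_le_nhds (this (h.isOpen_source.mem_nhds hu))
  refine ge_of_tendsto (hlim.norm.const_mul (K : ℝ)) ?_
  filter_upwards [hmem, self_mem_nhdsWithin] with t ht ht0
  have ht0 : 0 < |t| := abs_pos.2 ht0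
  have := h.dist_le _ ht _ hu
  rw [dist_eq_norm, dist_eq_norm, add_sub_cancel_left, norm_smul, Real.norm_eq_abs] at this
  rw [norm_smul, norm_inv, Real.norm_eq_abs, ← mul_assoc, mul_comm (K : ℝ), mul_assoc,
    ← div_eq_inv_mul, le_div_iff₀ ht0, mul_comm]
  exact this

theorem norm_fderiv_le (h : IsBilipschitzChart K φ U E V) (hu : u ∈ U)
    (hD : HasFDerivAt φ D u) : ‖D‖ ≤ K :=
  hD.le_of_lipschitzOn (h.isOpen_source.mem_nhds hu) h.lipschitz

theorem injective_fderiv (h : IsBilipschitzChart K φ U E V) (hu : u ∈ U)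
    (hD : HasFDerivAt φ D u) : Function.Injective D := by
  refine (injective_iff_map_eq_zero D).2 fun w hw => ?_
  simpa [hw] using h.norm_le_mul_norm_fderiv hu hD w

/-- The differential of a chart is a global chart of its range. -/
theorem fderiv_range (h : IsBilipschitzChart K φ U E V) (hu : u ∈ U) (hD : HasFDerivAt φ D u) :
    IsBilipschitzChart K D univ (D.range : Set G) univ where
  isOpen_source := isOpen_univ
  isOpen_target := isOpen_univ
  image_eq := by rw [image_univ, inter_univ]; rfl
  lipschitz := (D.lipschitz.weaken (h.norm_fderiv_le hu hD)).lipschitzOnWith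
  dist_le v _ w _ := by
    simpa [dist_eq_norm] using h.norm_le_mul_norm_fderiv hu hD (v - w)

end IsBilipschitzChart

namespace IsBilipschitzChart

variable {n d : ℕ} {K : ℝ≥0}
  {φ : EuclideanSpace ℝ (Fin d) → EuclideanSpace ℝ (Fin n)} {U : Set (EuclideanSpace ℝ (Fin d))}
  {E V : Set (EuclideanSpace ℝ (Fin n))} {u : EuclideanSpace ℝ (Fin d)}
  {D : EuclideanSpace ℝ (Fin d) →L[ℝ] EuclideanSpace ℝ (Fin n)}

/-- Where a chart is differentiable, the range of its differential is the tangent plane. -/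
theorem isTangentPlane (h : IsBilipschitzChart K φ U E V) (hu : u ∈ U)
    (hD : HasFDerivAt φ D u) : IsTangentPlane d E (φ u) D.range := by
  refine ⟨?_, ?_, ?_⟩
  · have := LinearMap.finrank_range_of_inj (f := D.toLinearMap) (h.injective_fderiv hu hD)
    simpa using this
  · refine h.isLittleO_nhdsWithin hu (g := fun y => Metric.infDist (y - φ u) (D.range : Set _)) ?_
    refine IsBigO.trans_isLittleO (IsBigO.of_bound 1 ?_) hD.isLittleO
    refine Eventually.of_forall fun w => ?_
    rw [one_mul, Real.norm_of_nonneg Metric.infDist_nonneg, ← dist_eq_norm]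
    exact Metric.infDist_le_dist_of_mem ⟨w - u, rfl⟩
  · have hchart := h.fderiv_range hu hD
    have := hchart.isLittleO_nhdsWithin (mem_univ 0)
      (g := fun v => Metric.infDist (φ u + v) E) ?_
    · simpa using this
    refine IsBigO.trans_isLittleO (IsBigO.of_bound 1 ?_)
      (by simpa using hasFDerivAt_iff_isLittleO_nhds_zero.1 hD)
    have hUu : ∀ᶠ w in 𝓝 (0 : EuclideanSpace ℝ (Fin d)), u + w ∈ U := by
      have : Tendsto (fun w => u + w) (𝓝 0) (𝓝 u) := by
        simpa using (by fun_prop : Continuous fun w => u + w).tendsto 0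
      exact this (h.isOpen_source.mem_nhds hu)
    filter_upwards [hUu] with w hw
    rw [one_mul, Real.norm_of_nonneg Metric.infDist_nonneg]
    refine (Metric.infDist_le_dist_of_mem (h.mem_image hw).1).trans_eq ?_
    rw [dist_comm, dist_eq_norm, sub_sub]

/-- Where both the chart and `f` in the chart are differentiable, `f` has a differential on the
tangent plane, and the chain rule holds. -/
theorem exists_hasTangentDifferential (h : IsBilipschitzChart K φ U E V) (hu : u ∈ U)
    (hD : HasFDerivAt φ D u) {f : EuclideanSpace ℝ (Fin n) → ℝ}
    {G : EuclideanSpace ℝ (Fin d) →L[ℝ] ℝ} (hG : HasFDerivAt (f ∘ φ) G u) :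
    ∃ L : D.range →L[ℝ] ℝ, HasTangentDifferential E f (φ u) D.range L ∧
      ∀ w, L ⟨D w, w, rfl⟩ = G w := by
  let e : EuclideanSpace ℝ (Fin d) ≃ₗ[ℝ] D.range :=
    LinearEquiv.ofInjective D.toLinearMap (h.injective_fderiv hu hD)
  let L : D.range →L[ℝ] ℝ := (G.toLinearMap ∘ₗ e.symm.toLinearMap).toContinuousLinearMap
  have hL : ∀ w, L ⟨D w, w, rfl⟩ = G w := by
    intro w
    have : e w = ⟨D w, w, rfl⟩ := rfl
    simp [L, ← this]
  refine ⟨L, ?_, hL⟩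
  refine h.isLittleO_nhdsWithin hu
    (g := fun y => f y - f (φ u) - L (D.range.orthogonalProjectionOnto (y - φ u))) ?_
  -- The projection fixes `D (w - u)`, so it differs from `D (w - u)` by the projected remainder.
  have hproj : (fun w => L (D.range.orthogonalProjectionOnto (φ w - φ u - D (w - u))))
      =o[𝓝 u] fun w => w - u :=
    ((L.comp D.range.orthogonalProjectionOnto).isBigO_comp _ _).trans_isLittleO hD.isLittleO
  refine (hG.isLittleO.sub hproj).congr_left fun w => ?_
  have hfix : D.range.orthogonalProjectionOnto (D (w - u)) = ⟨D (w - u), w - u, rfl⟩ :=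
    Submodule.orthogonalProjectionOnto_mem_subspace_eq_self (⟨D (w - u), w - u, rfl⟩ : D.range)
  rw [map_sub D.range.orthogonalProjectionOnto, map_sub L, hfix, hL]
  simp only [Function.comp_apply]
  ring

end IsBilipschitzChart

/-- A locally Lipschitz function on a Lipschitz submanifold is Lipschitz in suitable charts. -/
theorem IsLipschitzSubmanifold.exists_chart {n d : ℕ} {E : Set (EuclideanSpace ℝ (Fin n))}
    (hE : IsLipschitzSubmanifold d E) {f : EuclideanSpace ℝ (Fin n) → ℝ}
    (hf : LocallyLipschitzOn E f) {x : EuclideanSpace ℝ (Fin n)} (hx : x ∈ E) :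
    ∃ (U : Set (EuclideanSpace ℝ (Fin d)))
      (φ : EuclideanSpace ℝ (Fin d) → EuclideanSpace ℝ (Fin n))
      (V : Set (EuclideanSpace ℝ (Fin n))) (K C : ℝ≥0),
      IsBilipschitzChart K φ U E V ∧ x ∈ V ∧ LipschitzOnWith C (f ∘ φ) U := by
  obtain ⟨U, φ, V, K, hU, hV, hxV, him, hlip, hanti⟩ := hE x hx
  obtain ⟨C, t, ht, hft⟩ := hf hx
  obtain ⟨W, hW, hxW, hWt⟩ := mem_nhdsWithin.1 ht
  have hsub : U ∩ φ ⁻¹' W ⊆ U := inter_subset_left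
  refine ⟨U ∩ φ ⁻¹' W, φ, V ∩ W, K, C * K, ⟨?_, hV.inter hW, ?_, hlip.mono hsub, ?_⟩, ⟨hxV, hxW⟩,
    hft.comp (hlip.mono hsub) ?_⟩
  · exact hlip.continuousOn.isOpen_inter_preimage hU hW
  · rw [image_inter_preimage, him, inter_assoc]
  · intro u hu w hw
    exact hanti.le_mul_dist ⟨u, hu.1⟩ ⟨w, hw.1⟩
  · intro u hu
    have : φ u ∈ E ∩ V := him ▸ mem_image_of_mem φ hu.1
    exact hWt ⟨hu.2, this.1⟩

/-! ### Null sets in charts -/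

namespace IsBilipschitzChart

variable {n d : ℕ} {K : ℝ≥0}
  {φ : EuclideanSpace ℝ (Fin d) → EuclideanSpace ℝ (Fin n)} {U : Set (EuclideanSpace ℝ (Fin d))}
  {E V : Set (EuclideanSpace ℝ (Fin n))}

theorem hausdorffMeasure_image_null (h : IsBilipschitzChart K φ U E V)
    {s : Set (EuclideanSpace ℝ (Fin d))} (hs : s ⊆ U)
    (h0 : μH[(d : ℝ)] s = 0) :
    μH[(d : ℝ)] (φ '' s) = 0 := by
  refine le_antisymm (((h.lipschitz.mono hs).hausdorffMeasure_image_le d.cast_nonneg).trans ?_)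
    zero_le
  simp [h0]

theorem hausdorffMeasure_preimage_null (h : IsBilipschitzChart K φ U E V)
    {s : Set (EuclideanSpace ℝ (Fin n))}
    (h0 : μH[(d : ℝ)] s = 0) :
    μH[(d : ℝ)] (U ∩ φ ⁻¹' s) = 0 := by
  have hanti : AntilipschitzWith K (fun u : U => φ u) :=
    AntilipschitzWith.of_le_mul_dist fun u w => h.dist_le u u.2 w w.2
  have himage : U ∩ φ ⁻¹' s = Subtype.val '' ((fun u : U => φ u) ⁻¹' s) := by
    ext u; simp [and_comm]
  rw [himage, isometry_subtype_coe.hausdorffMeasure_image (Or.inl d.cast_nonneg)]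
  refine le_antisymm ((hanti.hausdorffMeasure_preimage_le d.cast_nonneg s).trans ?_) zero_le
  simp [h0]

end IsBilipschitzChart

/-- Hausdorff measure of the right dimension is a Haar measure, so that Rademacher's theorem and
Fubini arguments apply to it directly. -/
theorem isAddHaarMeasure_hausdorffMeasure_euclideanSpace (d : ℕ) :
    (μH[(d : ℝ)] : Measure (EuclideanSpace ℝ (Fin d))).IsAddHaarMeasure := by
  have := MeasureTheory.isAddHaarMeasure_hausdorffMeasure (E := EuclideanSpace ℝ (Fin d))
  rwa [finrank_euclideanSpace_fin] at this

theorem LipschitzOnWith.ae_differentiableAt_of_isOpen {F H : Type*} [NormedAddCommGroup F]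
    [NormedSpace ℝ F] [FiniteDimensional ℝ F] [MeasurableSpace F] [BorelSpace F]
    [NormedAddCommGroup H] [NormedSpace ℝ H] [FiniteDimensional ℝ H] (μ : Measure F)
    [μ.IsAddHaarMeasure] {C : ℝ≥0} {g : F → H} {s : Set F} (hg : LipschitzOnWith C g s)
    (hs : IsOpen s) : ∀ᵐ x ∂μ, x ∈ s → DifferentiableAt ℝ g x := by
  filter_upwards [hg.ae_differentiableWithinAt_of_mem (μ := μ)] with x hx hxs
  exact (hx hxs).differentiableAt (hs.mem_nhds hxs)

/-! ### Almost everywhere existence of tangent planes and differentials -/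

theorem IsBilipschitzChart.ae_differentiableAt {n d : ℕ} {K C : ℝ≥0}
    {φ : EuclideanSpace ℝ (Fin d) → EuclideanSpace ℝ (Fin n)} {U : Set (EuclideanSpace ℝ (Fin d))}
    {E V : Set (EuclideanSpace ℝ (Fin n))} (h : IsBilipschitzChart K φ U E V)
    {f : EuclideanSpace ℝ (Fin n) → ℝ} (hf : LipschitzOnWith C (f ∘ φ) U) :
    ∀ᵐ u ∂(μH[(d : ℝ)] : Measure (EuclideanSpace ℝ (Fin d))), u ∈ U →
      DifferentiableAt ℝ φ u ∧ DifferentiableAt ℝ (f ∘ φ) u := by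
  have := isAddHaarMeasure_hausdorffMeasure_euclideanSpace d
  filter_upwards [h.lipschitz.ae_differentiableAt_of_isOpen μH[(d : ℝ)] h.isOpen_source,
    hf.ae_differentiableAt_of_isOpen μH[(d : ℝ)] h.isOpen_source] with u h1 h2 hu
  exact ⟨h1 hu, h2 hu⟩

theorem IsLipschitzSubmanifold.ae_exists_hasTangentDifferential {n d : ℕ}
    {E : Set (EuclideanSpace ℝ (Fin n))} (hE : IsLipschitzSubmanifold d E)
    {f : EuclideanSpace ℝ (Fin n) → ℝ} (hf : LocallyLipschitzOn E f) :
    ∀ᵐ x ∂(μH[(d : ℝ)] : Measure (EuclideanSpace ℝ (Fin n))), x ∈ E →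
      ∃ T : Submodule ℝ (EuclideanSpace ℝ (Fin n)), IsTangentPlane d E x T ∧
        ∃ L : T →L[ℝ] ℝ, HasTangentDifferential E f x T L := by
  rw [ae_iff]
  refine measure_null_of_locally_null _ fun x hx => ?_
  obtain ⟨hxE, -⟩ := Classical.not_imp.1 hx
  obtain ⟨U, φ, V, K, C, h, hxV, hfφ⟩ := hE.exists_chart hf hxE
  refine ⟨_, inter_mem self_mem_nhdsWithin (nhdsWithin_le_nhds (h.isOpen_target.mem_nhds hxV)), ?_⟩
  refine measure_mono_null ?_ (h.hausdorffMeasure_image_null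
    (s := {u | ¬ (u ∈ U → DifferentiableAt ℝ φ u ∧ DifferentiableAt ℝ (f ∘ φ) u)})
    (fun u hu => (Classical.not_imp.1 hu).1) (h.ae_differentiableAt hfφ))
  rintro y ⟨hy, hyV⟩
  obtain ⟨hyE, hyT⟩ := Classical.not_imp.1 hy
  obtain ⟨u, hu, rfl⟩ : y ∈ φ '' U := h.image_eq ▸ ⟨hyE, hyV⟩
  refine mem_image_of_mem φ fun hdiff => hyT ?_
  obtain ⟨h1, h2⟩ := hdiff hu
  obtain ⟨L, hL, -⟩ := h.exists_hasTangentDifferential hu h1.hasFDerivAt h2.hasFDerivAt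
  exact ⟨_, h.isTangentPlane hu h1.hasFDerivAt, L, hL⟩

/-! ### Whitney differentiability -/

/-- If the tangential differential of `f` is the restriction of `A` almost everywhere, then in a
chart the gradient of `f` is `A` composed with the differential of the chart almost everywhere. -/
theorem IsBilipschitzChart.ae_hasFDerivAt_comp {n d : ℕ} {K C : ℝ≥0}
    {φ : EuclideanSpace ℝ (Fin d) → EuclideanSpace ℝ (Fin n)} {U : Set (EuclideanSpace ℝ (Fin d))}
    {E V : Set (EuclideanSpace ℝ (Fin n))} (h : IsBilipschitzChart K φ U E V)
    {f : EuclideanSpace ℝ (Fin n) → ℝ} (hf : LipschitzOnWith C (f ∘ φ) U)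
    {A : EuclideanSpace ℝ (Fin n) → (EuclideanSpace ℝ (Fin n) →L[ℝ] ℝ)}
    (hA : ∀ᵐ x ∂(μH[(d : ℝ)] : Measure (EuclideanSpace ℝ (Fin n))), x ∈ E →
      ∀ T : Submodule ℝ (EuclideanSpace ℝ (Fin n)), IsTangentPlane d E x T →
        ∀ L : T →L[ℝ] ℝ, HasTangentDifferential E f x T L → L = (A x).comp T.subtypeL) :
    ∀ᵐ u ∂(μH[(d : ℝ)] : Measure (EuclideanSpace ℝ (Fin d))), u ∈ U →
      ∃ D, HasFDerivAt φ D u ∧ HasFDerivAt (f ∘ φ) ((A (φ u)).comp D) u := by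
  have hpre := measure_eq_zero_iff_ae_notMem.1 (h.hausdorffMeasure_preimage_null (ae_iff.1 hA))
  filter_upwards [h.ae_differentiableAt hf, hpre] with u hdiff hAu hu
  obtain ⟨h1, h2⟩ := hdiff hu
  have hAu : φ u ∈ E → _ := not_not.1 fun hcon => hAu ⟨hu, hcon⟩
  obtain ⟨L, hL, hLG⟩ := h.exists_hasTangentDifferential hu h1.hasFDerivAt h2.hasFDerivAt
  have hLA := hAu (h.mem_image hu).1 _ (h.isTangentPlane hu h1.hasFDerivAt) L hL
  refine ⟨_, h1.hasFDerivAt, ?_⟩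
  convert h2.hasFDerivAt using 1
  ext1 w
  rw [← hLG, hLA]
  rfl

/-- Near the point `a = φ u`, the function `f - A a` has a small Lipschitz constant on `E`: in the
chart its gradient is `(A (φ w) - A a) ∘ D` almost everywhere, which is small by continuity of `A`,
and small balls in the chart are convex. One factor `K` bounds `D`, the other the inverse chart. -/
theorem IsBilipschitzChart.exists_nhds_lipschitzOnWith_sub {n d : ℕ} {K C : ℝ≥0}
    {φ : EuclideanSpace ℝ (Fin d) → EuclideanSpace ℝ (Fin n)} {U : Set (EuclideanSpace ℝ (Fin d))}
    {E V : Set (EuclideanSpace ℝ (Fin n))} (h : IsBilipschitzChart K φ U E V)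
    {f : EuclideanSpace ℝ (Fin n) → ℝ} (hf : LipschitzOnWith C (f ∘ φ) U)
    {A : EuclideanSpace ℝ (Fin n) → (EuclideanSpace ℝ (Fin n) →L[ℝ] ℝ)} (hAc : ContinuousOn A E)
    (hA : ∀ᵐ x ∂(μH[(d : ℝ)] : Measure (EuclideanSpace ℝ (Fin n))), x ∈ E →
      ∀ T : Submodule ℝ (EuclideanSpace ℝ (Fin n)), IsTangentPlane d E x T →
        ∀ L : T →L[ℝ] ℝ, HasTangentDifferential E f x T L → L = (A x).comp T.subtypeL)
    {u : EuclideanSpace ℝ (Fin d)} (hu : u ∈ U) {ε : ℝ≥0} (hε : 0 < ε) :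
    ∃ s ∈ 𝓝[E] (φ u), LipschitzOnWith (ε * K * K) (fun y => f y - A (φ u) y) s := by
  have := isAddHaarMeasure_hausdorffMeasure_euclideanSpace d
  have hcont : ContinuousOn (A ∘ φ) U :=
    hAc.comp h.lipschitz.continuousOn fun w hw => (h.mem_image hw).1
  have hnear : ∀ᶠ w in 𝓝 u, w ∈ U ∧ dist (A (φ w)) (A (φ u)) < ε :=
    Eventually.and (h.isOpen_source.mem_nhds hu)
      ((hcont.continuousAt (h.isOpen_source.mem_nhds hu)).eventually
        (Metric.ball_mem_nhds _ (NNReal.coe_pos.2 hε)))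
  obtain ⟨r, hr, hball⟩ := Metric.eventually_nhds_iff_ball.1 hnear
  have hBU : Metric.ball u r ⊆ U := fun w hw => (hball w hw).1
  have hlin : LipschitzOnWith (‖A (φ u)‖₊ * K) (A (φ u) ∘ φ) (Metric.ball u r) :=
    (A (φ u)).lipschitz.comp_lipschitzOnWith (h.lipschitz.mono hBU)
  have hlip : LipschitzOnWith (ε * K) (f ∘ φ - A (φ u) ∘ φ) (Metric.ball u r) := by
    refine lipschitzOnWith_of_ae_norm_fderiv_le μH[(d : ℝ)] (convex_ball u r) Metric.isOpen_ball
      ((hf.mono hBU).sub hlin) ?_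
    filter_upwards [h.ae_hasFDerivAt_comp hf hA] with w hw hwB
    obtain ⟨D, hD, hG⟩ := hw (hBU hwB)
    have hder := hG.sub ((A (φ u)).hasFDerivAt.comp w hD)
    refine ⟨hder.differentiableAt, ?_⟩
    rw [hder.fderiv, ← ContinuousLinearMap.sub_comp, NNReal.coe_mul]
    refine (ContinuousLinearMap.opNorm_comp_le _ _).trans ?_
    have h1 : ‖A (φ w) - A (φ u)‖ ≤ ε := by
      rw [← dist_eq_norm]; exact (hball w hwB).2.le
    have h2 := h.norm_fderiv_le (hBU hwB) hD
    gcongr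
  refine ⟨φ '' Metric.ball u r,
    h.nhdsWithin_le_map hu (image_mem_map (Metric.ball_mem_nhds u hr)), ?_⟩
  refine LipschitzOnWith.of_dist_le_mul ?_
  rintro _ ⟨w, hw, rfl⟩ _ ⟨w', hw', rfl⟩
  refine (hlip.dist_le_mul w hw w' hw').trans ?_
  rw [NNReal.coe_mul (ε * K), mul_assoc]
  gcongr
  exact h.dist_le w (hBU hw) w' (hBU hw')

theorem IsLipschitzSubmanifold.isWhitneyC1With {n d : ℕ}
    {E : Set (EuclideanSpace ℝ (Fin n))} (hE : IsLipschitzSubmanifold d E)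
    {f : EuclideanSpace ℝ (Fin n) → ℝ} (hf : LocallyLipschitzOn E f)
    {A : EuclideanSpace ℝ (Fin n) → (EuclideanSpace ℝ (Fin n) →L[ℝ] ℝ)} (hAc : ContinuousOn A E)
    (hA : ∀ᵐ x ∂(μH[(d : ℝ)] : Measure (EuclideanSpace ℝ (Fin n))), x ∈ E →
      ∀ T : Submodule ℝ (EuclideanSpace ℝ (Fin n)), IsTangentPlane d E x T →
        ∀ L : T →L[ℝ] ℝ, HasTangentDifferential E f x T L → L = (A x).comp T.subtypeL) :
    IsWhitneyC1With E f A := by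
  refine ⟨hAc, fun a ha => ?_⟩
  obtain ⟨U, φ, V, K, C, h, haV, hfφ⟩ := hE.exists_chart hf ha
  obtain ⟨u, hu, rfl⟩ : a ∈ φ '' U := h.image_eq ▸ ⟨ha, haV⟩
  refine isLittleO_iff.2 fun c hc => ?_
  -- The error is the sum of `ε * K * K` from `f - A a` and of `ε` from `A x - A a`.
  obtain ⟨ε, hε, hεc⟩ : ∃ ε : ℝ≥0, 0 < ε ∧ (ε * K * K + ε : ℝ) = c := by
    have hpos : 0 < c / (K * K + 1) := by positivity
    refine ⟨(c / (K * K + 1)).toNNReal, Real.toNNReal_pos.2 hpos, ?_⟩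
    rw [Real.coe_toNNReal _ hpos.le]
    field_simp
  obtain ⟨s, hs, hlip⟩ := h.exists_nhds_lipschitzOnWith_sub hfφ hAc hA hu hε
  have hsA : ∀ᶠ x in 𝓝[E] (φ u), x ∈ s ∧ dist (A x) (A (φ u)) < ε :=
    Eventually.and hs ((hAc (φ u) ha) (Metric.ball_mem_nhds _ (NNReal.coe_pos.2 hε)))
  rw [nhdsWithin_prod_eq]
  filter_upwards [prod_mem_prod hsA hsA] with ⟨x, y⟩ ⟨⟨hxs, hxA⟩, ⟨hys, _⟩⟩
  have h1 := hlip.dist_le_mul y hys x hxs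
  have h2 : ‖(A x - A (φ u)) (y - x)‖ ≤ ε * ‖y - x‖ := by
    refine (ContinuousLinearMap.le_opNorm _ _).trans ?_
    gcongr
    rw [← dist_eq_norm]
    exact hxA.le
  rw [dist_eq_norm, dist_eq_norm] at h1
  have hsplit : f y - f x - A x (y - x)
      = (f y - A (φ u) y - (f x - A (φ u) x)) - (A x - A (φ u)) (y - x) := by
    simp only [sub_apply, map_sub]
    ring
  calc ‖f y - f x - A x (y - x)‖
      ≤ ‖f y - A (φ u) y - (f x - A (φ u) x)‖ + ‖(A x - A (φ u)) (y - x)‖ := by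
        rw [hsplit]; exact norm_sub_le _ _
    _ ≤ (ε * K * K) * ‖y - x‖ + ε * ‖y - x‖ := add_le_add (by simpa using h1) h2
    _ = c * ‖y - x‖ := by rw [← add_mul, hεc]

theorem mainTheorem3 (n d : ℕ) (E : Set (EuclideanSpace ℝ (Fin n))) (hclosed : IsClosed E)
    (hE : IsLipschitzSubmanifold d E) (k : ℝ) (hk : 1 ≤ k) (hpath : PathCondition k E)
    (f : EuclideanSpace ℝ (Fin n) → ℝ) (hf : LocallyLipschitzOn E f) :
    (∀ᵐ x ∂(Measure.hausdorffMeasure (d : ℝ) : Measure (EuclideanSpace ℝ (Fin n))), x ∈ E →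
      ∃ T : Submodule ℝ (EuclideanSpace ℝ (Fin n)), IsTangentPlane d E x T ∧
        ∃ L : T →L[ℝ] ℝ, HasTangentDifferential E f x T L) ∧
    ∀ A : EuclideanSpace ℝ (Fin n) → (EuclideanSpace ℝ (Fin n) →L[ℝ] ℝ), ContinuousOn A E →
      (∀ᵐ x ∂(Measure.hausdorffMeasure (d : ℝ) : Measure (EuclideanSpace ℝ (Fin n))), x ∈ E →
        ∀ T : Submodule ℝ (EuclideanSpace ℝ (Fin n)), IsTangentPlane d E x T →
          ∀ L : T →L[ℝ] ℝ, HasTangentDifferential E f x T L →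
            L = (A x).comp T.subtypeL) →
      IsWhitneyC1With E f A :=
  ⟨hE.ae_exists_hasTangentDifferential hf, fun _ hAc hA => hE.isWhitneyC1With hf hAc hA⟩
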